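/- Let $n\ge 2$ and let $n$ planar point vortices with positions $z_i\in\mathbb R^2$ and circulations $\Gamma_i>0$ evolve by $M\dot z=K\nabla H(z)$ on the collision-free configurations $z=(z_1,\dots,z_n)\in\mathbb R^{2n}$, where $H(z)=-\sum_{i<j}\Gamma_i\Gamma_j\ln\|z_i-z_j\|$, $M=\mathrm{diag}(\Gamma_1,\Gamma_1,\dots,\Gamma_n,\Gamma_n)$, and $K$ is block diagonal with each diagonal block equal to $J=\begin{bmatrix}0&1\\-1&0\end{bmatrix}$. A point $z_0$ is a relative equilibrium with angular velocity $\omega\neq 0$ if $t\mapsto e^{-\omega Jt}z_0=(e^{-\omega Jt}z_{0,1},\dots,e^{-\omega Jt}z_{0,n})$ is a solution. In the frame rotating with angular velocity $\omega$ the equations become $$M\dot z=K(\nabla H(z)+\omega Mz). \qquad (*)$$ Put $B=K(M^{-1}D^2H(z_0)+\omega\,\mathrm{Id})$, $V=\mathrm{span}\{z_0,Kz_0\}$ and $V^\perp=\{w\in\mathbb R^{2n}: w^TMv=0\ \ \forall v\in V\}$. The relative equilibrium $z_0$ is called linearly stable if, apart from the four trivial eigenvalues $0,0,\pm\omega i$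 (counted with algebraic multiplicity), all $2n-4$ remaining eigenvalues of $B$ are nonzero and purely imaginary, and the restriction of $B$ to $V^\perp$ is, in some real basis, block diagonal with blocks $\begin{bmatrix}0&\beta_j\\-\beta_j&0\end{bmatrix}$, $\beta_j\in\mathbb R$. Theorem. Suppose $\Gamma_i>0$ for all $i$. Then every linearly stable relative equilibrium $z_0$ is nonlinearly stable: with $\gamma=\{e^{J\theta}z_0:\theta\in\mathbb R\}$, for every $\epsilon>0$ there is a $\delta>0$ such that, whenever $\|\zeta_0-z_0\|<\delta$, the (unique) solution $\phi(t,\zeta_0)$ of $(*)$ with $\phi(0,\zeta_0)=\zeta_0$ exists for all $t\in\mathbb R$ and satisfies $$\min_{z\in\gamma}\|\phi(t,\zeta_0)-z\|<\epsilon\quad\text{for all } t\in\mathbb R.$$ -/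

import Mathlib

open scoped Kronecker

noncomputable section

namespace PointVortex

/-- The space `ℝ²ⁿ` of positions of `n` planar vortices, with the Euclidean norm; the coordinate
`z (i, 0)` is `x_i` and `z (i, 1)` is `y_i`. -/
abbrev Config (n : ℕ) : Type := EuclideanSpace ℝ (Fin n × Fin 2)

variable {n : ℕ}

/-- The position `z_i = (x_i, y_i)` of the `i`-th vortex. -/
def pos (z : Config n) (i : Fin n) : EuclideanSpace ℝ (Fin 2) := !₂[z (i, 0), z (i, 1)]

/-- The mutual distance `r_ij = ‖z_i - z_j‖`. -/
def mutualDist (z : Config n) (i j : Fin n) : ℝ := ‖pos z i - pos z j‖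

/-- No two vortices are at the same place: the domain of the equations of motion. -/
def CollisionFree (z : Config n) : Prop := ∀ i j : Fin n, i ≠ j → pos z i ≠ pos z j

/-- The Hamiltonian `H = - ∑_{i<j} Γ_i Γ_j ln r_ij`. -/
def hamiltonian (Γ : Fin n → ℝ) (z : Config n) : ℝ :=
  - ∑ i : Fin n, ∑ j ∈ Finset.Ioi i, Γ i * Γ j * Real.log (mutualDist z i j)

/-- The standard `2 × 2` symplectic matrix. -/
def matJ : Matrix (Fin 2) (Fin 2) ℝ := !![0, 1; -1, 0]

/-- The block diagonal `2n × 2n` matrix with `J` in each diagonal block, acting on `ℝ²ⁿ`. -/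
def opK (n : ℕ) : Config n →L[ℝ] Config n :=
  Matrix.toEuclideanCLM (𝕜 := ℝ) ((1 : Matrix (Fin n) (Fin n) ℝ) ⊗ₖ matJ)

/-- The matrix of circulations `M = diag (Γ₁, Γ₁, …, Γₙ, Γₙ)`, acting on `ℝ²ⁿ`. -/
def opM (Γ : Fin n → ℝ) : Config n →L[ℝ] Config n :=
  Matrix.toEuclideanCLM (𝕜 := ℝ) (Matrix.diagonal fun p : Fin n × Fin 2 => Γ p.1)

/-- The inverse of `M` (the circulations are nonzero), acting on `ℝ²ⁿ`. -/
def opMinv (Γ : Fin n → ℝ) : Config n →L[ℝ] Config n :=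
  Matrix.toEuclideanCLM (𝕜 := ℝ) (Matrix.diagonal fun p : Fin n × Fin 2 => (Γ p.1)⁻¹)

/-- The rotation `e^{Jθ} z = (e^{Jθ} z₁, …, e^{Jθ} zₙ)`; as `J² = -1`, `e^{Jθ} = cos θ + sin θ J`. -/
def rot (θ : ℝ) (z : Config n) : Config n := Real.cos θ • z + Real.sin θ • opK n z

/-- `φ` is, on the set of times `S`, a collision-free solution of
`M ż = K (∇H(z) + ω M z)`: for `ω = 0` these are the equations of motion `M ż = K ∇H(z)` in the
fixed frame, in general the equations in the frame that rotates with angular velocity `ω`. -/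
def IsSolutionOn (Γ : Fin n → ℝ) (ω : ℝ) (φ : ℝ → Config n) (S : Set ℝ) : Prop :=
  ∀ t ∈ S, CollisionFree (φ t) ∧
    ∃ v : Config n, HasDerivAt φ v t ∧
      opM Γ v = opK n (gradient (hamiltonian Γ) (φ t) + ω • opM Γ (φ t))

/-- `z₀` is (the initial position of) a relative equilibrium with angular velocity `ω ≠ 0`:
`t ↦ e^{-ωJt} z₀` solves the equations of motion in the fixed frame. -/
def IsRelativeEquilibrium (Γ : Fin n → ℝ) (ω : ℝ) (z₀ : Config n) : Prop :=
  ω ≠ 0 ∧ IsSolutionOn Γ 0 (fun t => rot (-ω * t) z₀) Set.univ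

/-- The Hessian `D²H(z)`, as an operator on `ℝ²ⁿ`: the derivative of the gradient of `H`. -/
def hessian (Γ : Fin n → ℝ) (z : Config n) : Config n →L[ℝ] Config n :=
  fderiv ℝ (gradient (hamiltonian Γ)) z

/-- The stability matrix `B = K (M⁻¹ D²H(z₀) + ω)`. -/
def stabilityOp (Γ : Fin n → ℝ) (ω : ℝ) (z₀ : Config n) : Config n →L[ℝ] Config n :=
  opK n ∘L (opMinv Γ ∘L hessian Γ z₀ + ω • ContinuousLinearMap.id ℝ (Config n))

/-- The eigenvalues of `B`, with algebraic multiplicity, other than the trivial ones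
`0, 0, ωi, -ωi`. -/
def nontrivialEigenvalues (Γ : Fin n → ℝ) (ω : ℝ) (z₀ : Config n) : Multiset ℂ :=
  (stabilityOp Γ ω z₀ : Config n →ₗ[ℝ] Config n).charpoly.aroots ℂ
    - {0, 0, (ω : ℂ) * Complex.I, -((ω : ℂ) * Complex.I)}

/-- The subspace `V = span {z₀, K z₀}`. -/
def subV (z₀ : Config n) : Submodule ℝ (Config n) := Submodule.span ℝ {z₀, opK n z₀}

/-- The `M`-orthogonal complement `{w : wᵀ M v = 0 for all v ∈ V}` of `V`. -/
def subVperp (Γ : Fin n → ℝ) (z₀ : Config n) : Submodule ℝ (Config n) where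
  carrier := {w | ∀ v ∈ subV z₀, inner ℝ w (opM Γ v) = 0}
  zero_mem' := fun v _ => inner_zero_left _
  add_mem' := fun {a b} ha hb v hv => by rw [inner_add_left, ha v hv, hb v hv, add_zero]
  smul_mem' := fun c w hw v hv => by rw [real_inner_smul_left, hw v hv, mul_zero]

/-- All nontrivial eigenvalues are nonzero. -/
def IsNondegenerate (Γ : Fin n → ℝ) (ω : ℝ) (z₀ : Config n) : Prop :=
  ∀ μ ∈ nontrivialEigenvalues Γ ω z₀, μ ≠ 0

/-- Nondegenerate, and all nontrivial eigenvalues are pure imaginary. -/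
def IsSpectrallyStable (Γ : Fin n → ℝ) (ω : ℝ) (z₀ : Config n) : Prop :=
  IsNondegenerate Γ ω z₀ ∧ ∀ μ ∈ nontrivialEigenvalues Γ ω z₀, μ.re = 0

/-- Spectrally stable and, in some basis `(e_j, f_j)` of the `M`-orthogonal complement of `V`, the
restriction of `B` is block diagonal with blocks `[0, β_j; -β_j, 0]`. -/
def IsLinearlyStable (Γ : Fin n → ℝ) (ω : ℝ) (z₀ : Config n) : Prop :=
  IsSpectrallyStable Γ ω z₀ ∧
    ∃ (m : ℕ) (b : Module.Basis (Fin m × Fin 2) ℝ (subVperp Γ z₀)) (β : Fin m → ℝ), ∀ j : Fin m,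
      stabilityOp Γ ω z₀ (b (j, 0)) = -β j • (b (j, 1) : Config n) ∧
      stabilityOp Γ ω z₀ (b (j, 1)) = β j • (b (j, 0) : Config n)

/-- The circle `γ` of rotated copies of `z₀`. -/
def orbitCircle (z₀ : Config n) : Set (Config n) := Set.range fun θ : ℝ => rot θ z₀

/-- `φ` is the solution, defined for all forward and backward time, of the equations in the frame
rotating with angular velocity `ω` with initial condition `ζ₀`: it is a solution on `ℝ`, and every
solution on an open interval around time `0` with the same initial condition agrees with it. -/
def IsTheSolution (Γ : Fin n → ℝ) (ω : ℝ) (ζ₀ : Config n) (φ : ℝ → Config n) : Prop :=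
  φ 0 = ζ₀ ∧ IsSolutionOn Γ ω φ Set.univ ∧
    ∀ (a b : ℝ) (ψ : ℝ → Config n), a < 0 → 0 < b → ψ 0 = ζ₀ →
      IsSolutionOn Γ ω ψ (Set.Ioo a b) → Set.EqOn ψ φ (Set.Ioo a b)

/-- For every `ε > 0` there is `δ > 0` such that the solution in the rotating frame of any initial
condition within `δ` of `z₀` exists for all time and stays within `ε` of the circle `γ`. -/
def IsNonlinearlyStable (Γ : Fin n → ℝ) (ω : ℝ) (z₀ : Config n) : Prop :=
  ∀ ε > 0, ∃ δ > 0, ∀ ζ₀ : Config n, ‖ζ₀ - z₀‖ < δ →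
    ∃ φ : ℝ → Config n, IsTheSolution Γ ω ζ₀ φ ∧
      ∀ t : ℝ, Metric.infDist (φ t) (orbitCircle z₀) < ε

end PointVortex

end

/-!
Write `A = M⁻¹ D²H(z₀)` and let `F(z) = H(z) + ω/2 ⟨z, M z⟩` be the Hamiltonian in the rotating
frame (`energy`). A relative equilibrium is a critical point of `F`, and the proof shows that linear
stability makes the whole circle `γ` a strict local minimum of `F`, which is then a Lyapunov
function: it is conserved along solutions.

The two-dimensional logarithm is harmonic, so its Hessian is trace free and anticommutes with the
quarter turn (`logNormHess_turn`); hence `A K = -K A` (`hessian_opK`), and `B = K (A + ω)` satisfies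
`B² = A² - ω²` (`stabilityOp_stabilityOp`). On the `M`-orthogonal complement of `V`, the block form
of `B` shows that the eigenvalues of `B²` are of the form `-β²`; none of them vanishes, because the
generalized kernel of `B` has dimension two by nondegeneracy and already contains `V`
(`eq_zero_of_stabilityOp_stabilityOp_eq_zero`). So an eigenvalue `μ` of `A` on this complement
satisfies `μ² < ω²`, while the homogeneity of `∇H` and `A K = -K A` give `A z₀ = ω z₀` and
`A K z₀ = -ω K z₀`. Since the circulations are positive, `ω > 0` and `A` is self-adjoint for the
inner product of `M`. It follows that `D²F(z₀) = M (A + ω)` is positive semidefinite with kernel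
spanned by the tangent `K z₀` of `γ`, and so is coercive on the hyperplane orthogonal to `K z₀`
(`exists_secondVariation_coercive`). The minimum of its Rayleigh quotient is an eigenvalue
(`exists_eigenvector_le_rayleigh`), so that the spectral theorem is not needed.

A configuration near `γ` can be rotated so that its nearest point on `γ` is `z₀`, and then lies in
this hyperplane through `z₀` (`exists_rot_nearest`). As `F` is rotation invariant, it grows at least
like the square of the distance to `γ` (`exists_energy_growth`). To have global solutions, `F` is
cut off outside a neighbourhood of `γ` to a smooth function of compact support (`exists_energy_cutoff`),
whose Hamiltonian vector field is bounded and Lipschitz. The cut-off energy is conserved, so a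
solution that starts near `z₀` never leaves the region where nothing was cut off, and therefore
solves the original equations.
-/

open scoped Kronecker

namespace PointVortex

variable {n : ℕ}

/-! ### The operators `K` and `M` -/

theorem opM_apply (Γ : Fin n → ℝ) (z : Config n) (p : Fin n × Fin 2) :
    opM Γ z p = Γ p.1 * z p := by
  simp [opM, Matrix.ofLp_toEuclideanCLM, Matrix.mulVec_diagonal]

theorem opMinv_apply (Γ : Fin n → ℝ) (z : Config n) (p : Fin n × Fin 2) :
    opMinv Γ z p = (Γ p.1)⁻¹ * z p := by
  simp [opMinv, Matrix.ofLp_toEuclideanCLM, Matrix.mulVec_diagonal]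

theorem opK_apply_zero (z : Config n) (i : Fin n) : opK n z (i, 0) = z (i, 1) := by
  simp [opK, Matrix.ofLp_toEuclideanCLM, Matrix.mulVec, dotProduct, Fintype.sum_prod_type,
    Matrix.one_apply, matJ]

theorem opK_apply_one (z : Config n) (i : Fin n) : opK n z (i, 1) = -z (i, 0) := by
  simp [opK, Matrix.ofLp_toEuclideanCLM, Matrix.mulVec, dotProduct, Fintype.sum_prod_type,
    Matrix.one_apply, matJ]

theorem config_ext {z w : Config n} (h0 : ∀ i, z (i, 0) = w (i, 0))
    (h1 : ∀ i, z (i, 1) = w (i, 1)) : z = w := by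
  ext ⟨i, k⟩
  fin_cases k
  exacts [h0 i, h1 i]

theorem inner_config (z w : Config n) :
    inner ℝ z w = ∑ i, (z (i, 0) * w (i, 0) + z (i, 1) * w (i, 1)) := by
  simp [PiLp.inner_apply, Fintype.sum_prod_type, mul_comm]

theorem opK_opK (z : Config n) : opK n (opK n z) = -z := by
  apply config_ext <;> intro i <;> simp [opK_apply_zero, opK_apply_one]

theorem opK_injective : Function.Injective (opK n) := fun z w h => by
  simpa [opK_opK] using congrArg (opK n) h

theorem inner_opK_left (z w : Config n) : inner ℝ (opK n z) w = -inner ℝ z (opK n w) := by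
  simp only [inner_config, ← Finset.sum_neg_distrib, opK_apply_zero, opK_apply_one]
  exact Finset.sum_congr rfl fun i _ => by ring

theorem inner_opK_self (z : Config n) : inner ℝ z (opK n z) = 0 := by
  have := inner_opK_left z z
  rw [real_inner_comm] at this
  linarith

theorem inner_opM_left (Γ : Fin n → ℝ) (z w : Config n) :
    inner ℝ (opM Γ z) w = inner ℝ z (opM Γ w) := by
  simp only [inner_config, opM_apply]
  exact Finset.sum_congr rfl fun i _ => by ring

theorem opM_opK (Γ : Fin n → ℝ) (z : Config n) : opM Γ (opK n z) = opK n (opM Γ z) := by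
  apply config_ext <;> intro i <;> simp [opK_apply_zero, opK_apply_one, opM_apply]

theorem opMinv_opK (Γ : Fin n → ℝ) (z : Config n) :
    opMinv Γ (opK n z) = opK n (opMinv Γ z) := by
  apply config_ext <;> intro i <;> simp [opK_apply_zero, opK_apply_one, opMinv_apply]

theorem opM_opMinv {Γ : Fin n → ℝ} (hΓ : ∀ i, 0 < Γ i) (z : Config n) :
    opM Γ (opMinv Γ z) = z := by
  ext p
  simp [opM_apply, opMinv_apply, (hΓ p.1).ne']

theorem opMinv_opM {Γ : Fin n → ℝ} (hΓ : ∀ i, 0 < Γ i) (z : Config n) :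
    opMinv Γ (opM Γ z) = z := by
  ext p
  simp [opM_apply, opMinv_apply, (hΓ p.1).ne']

theorem inner_opK_opM (Γ : Fin n → ℝ) (z : Config n) : inner ℝ (opK n z) (opM Γ z) = 0 := by
  have h := inner_opM_left Γ z (opK n z)
  rw [opM_opK, real_inner_comm] at h
  have h2 := inner_opK_left z (opM Γ z)
  linarith

theorem inner_opM_self_pos {Γ : Fin n → ℝ} (hΓ : ∀ i, 0 < Γ i) {z : Config n} (hz : z ≠ 0) :
    0 < inner ℝ z (opM Γ z) := by
  have h : inner ℝ z (opM Γ z) = ∑ p, Γ p.1 * z p ^ 2 := by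
    simp only [PiLp.inner_apply, opM_apply, real_inner_eq_re_inner]
    exact Finset.sum_congr rfl fun i _ => by simp; ring
  rw [h]
  obtain ⟨p, hp⟩ : ∃ p, z p ≠ 0 := by
    by_contra! hc
    exact hz (by ext p; simp [hc p])
  exact Finset.sum_pos' (fun p _ => mul_nonneg (hΓ _).le (sq_nonneg _))
    ⟨p, Finset.mem_univ _, mul_pos (hΓ _) (by positivity)⟩

/-! ### Rotations -/

theorem norm_opK (z : Config n) : ‖opK n z‖ = ‖z‖ := by
  have h := inner_opK_left z (opK n z)
  rw [opK_opK, inner_neg_right, neg_neg, real_inner_self_eq_norm_sq,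
    real_inner_self_eq_norm_sq] at h
  exact (pow_left_inj₀ (norm_nonneg _) (norm_nonneg _) two_ne_zero).1 h

theorem rot_zero (z : Config n) : rot 0 z = z := by simp [rot]

theorem rot_rot (a b : ℝ) (z : Config n) : rot a (rot b z) = rot (a + b) z := by
  simp only [rot, map_add, map_smul, opK_opK, Real.cos_add, Real.sin_add]
  module

theorem rot_neg_rot (a : ℝ) (z : Config n) : rot (-a) (rot a z) = z := by
  rw [rot_rot, neg_add_cancel, rot_zero]

theorem rot_sub (a : ℝ) (z w : Config n) : rot a (z - w) = rot a z - rot a w := by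
  simp only [rot, map_sub]
  module

theorem norm_rot (a : ℝ) (z : Config n) : ‖rot a z‖ = ‖z‖ := by
  rw [← pow_left_inj₀ (norm_nonneg _) (norm_nonneg _) two_ne_zero, rot, norm_add_sq_real,
    norm_smul, norm_smul, norm_opK, real_inner_smul_left, real_inner_smul_right, inner_opK_self,
    mul_pow, mul_pow, Real.norm_eq_abs, Real.norm_eq_abs, sq_abs, sq_abs]
  linear_combination ‖z‖ ^ 2 * Real.sin_sq_add_cos_sq a

theorem opM_rot (Γ : Fin n → ℝ) (a : ℝ) (z : Config n) : opM Γ (rot a z) = rot a (opM Γ z) := by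
  simp [rot, opM_opK]

theorem inner_rot_opM_rot (Γ : Fin n → ℝ) (a : ℝ) (z : Config n) :
    inner ℝ (rot a z) (opM Γ (rot a z)) = inner ℝ z (opM Γ z) := by
  have h1 : inner ℝ z (opK n (opM Γ z)) = 0 := by
    have := inner_opK_left z (opM Γ z)
    rw [inner_opK_opM] at this
    linarith
  have h2 : inner ℝ (opK n z) (opK n (opM Γ z)) = inner ℝ z (opM Γ z) := by
    rw [inner_opK_left, opK_opK, inner_neg_right, neg_neg]
  rw [opM_rot]
  simp only [rot, inner_add_left, inner_add_right, real_inner_smul_left, real_inner_smul_right,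
    inner_opK_opM, h1, h2]
  linear_combination inner ℝ z (opM Γ z) * Real.sin_sq_add_cos_sq a

theorem hasDerivAt_rot (z : Config n) (a : ℝ) :
    HasDerivAt (fun t => rot t z) (opK n (rot a z)) a := by
  have h := ((Real.hasDerivAt_cos a).smul_const z).add
    ((Real.hasDerivAt_sin a).smul_const (opK n z))
  refine h.congr_deriv ?_
  simp only [rot, map_add, map_smul, opK_opK]
  module

theorem continuous_rot (z : Config n) : Continuous fun a => rot a z :=
  continuous_iff_continuousAt.2 fun a => (hasDerivAt_rot z a).continuousAt

theorem isCompact_orbitCircle (z : Config n) : IsCompact (orbitCircle z) := by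
  have h : orbitCircle z = (fun a => rot a z) '' Set.Icc 0 (2 * Real.pi) := by
    have hp : Function.Periodic (fun a => rot a z) (2 * Real.pi) := fun a => by simp [rot]
    rw [orbitCircle, ← zero_add (2 * Real.pi), hp.image_Icc Real.two_pi_pos]
  rw [h]
  exact isCompact_Icc.image (continuous_rot z)

/-! ### Gradient and Hessian of the logarithm of the norm -/

section LogNorm

variable {E : Type*} [NormedAddCommGroup E] [InnerProductSpace ℝ E]

/-- The gradient `x / ‖x‖²` of `log ‖x‖`, with the value `0` at `x = 0`. -/
noncomputable def logNormGrad (x : E) : E := (‖x‖ ^ 2)⁻¹ • x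

/-- The Hessian of `log ‖x‖`, as the operator `u ↦ u / ‖x‖² - 2 ⟨x, u⟩ x / ‖x‖⁴`,
with the value `0` at `x = 0`. -/
noncomputable def logNormHess (x : E) : E →L[ℝ] E :=
  (‖x‖ ^ 2)⁻¹ • ContinuousLinearMap.id ℝ E
    - (2 * ((‖x‖ ^ 2) ^ 2)⁻¹) • (innerSL ℝ x).smulRight x

theorem logNormHess_apply (x u : E) :
    logNormHess x u = (‖x‖ ^ 2)⁻¹ • u - (2 * ((‖x‖ ^ 2) ^ 2)⁻¹ * inner ℝ x u) • x := by
  simp [logNormHess, smul_smul]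

theorem hasFDerivAt_log_norm {x : E} (hx : x ≠ 0) :
    HasFDerivAt (fun y : E => Real.log ‖y‖) (innerSL ℝ (logNormGrad x)) x := by
  have hx2 : ‖x‖ ^ 2 ≠ 0 := by positivity
  have h := (((hasStrictFDerivAt_norm_sq x).hasFDerivAt.log hx2).const_mul (1 / 2 : ℝ))
  have he : (fun y : E => Real.log ‖y‖) = fun y => 1 / 2 * Real.log (‖y‖ ^ 2) := by
    funext y
    rw [Real.log_pow]
    push_cast
    ring
  rw [he]
  refine h.congr_fderiv ?_
  ext u
  simp [logNormGrad]
  ring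

theorem hasFDerivAt_logNormGrad {x : E} (hx : x ≠ 0) :
    HasFDerivAt logNormGrad (logNormHess x) x := by
  have hx2 : ‖x‖ ^ 2 ≠ 0 := by positivity
  have h := ((hasDerivAt_inv hx2).comp_hasFDerivAt x
    (hasStrictFDerivAt_norm_sq x).hasFDerivAt).smul (hasFDerivAt_id x)
  refine h.congr_fderiv ?_
  ext u
  simp only [logNormHess_apply]
  simp only [add_apply, smul_apply,
    ContinuousLinearMap.smulRight_apply, Function.comp_apply, id, innerSL_apply_apply,
    ContinuousLinearMap.id_apply, smul_eq_mul, nsmul_eq_mul]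
  module

theorem logNormHess_self (x : E) : logNormHess x x = -logNormGrad x := by
  rcases eq_or_ne x 0 with rfl | hx
  · simp [logNormGrad]
  have hx2 : ‖x‖ ≠ 0 := by positivity
  rw [logNormHess_apply, logNormGrad, real_inner_self_eq_norm_sq, ← sub_smul, ← neg_smul]
  congr 1
  field_simp
  ring

theorem inner_logNormGrad_self {x : E} (hx : x ≠ 0) : inner ℝ (logNormGrad x) x = 1 := by
  rw [logNormGrad, real_inner_smul_left, real_inner_self_eq_norm_sq]
  exact inv_mul_cancel₀ (by positivity)

theorem inner_logNormHess_left (x u v : E) :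
    inner ℝ (logNormHess x u) v = inner ℝ u (logNormHess x v) := by
  simp only [logNormHess_apply, inner_sub_left, inner_sub_right, real_inner_smul_left,
    real_inner_smul_right, real_inner_comm u x]
  ring

end LogNorm

/-! ### Pairs of vortices -/

/-- The displacement `z_i - z_j`, as a linear map of the configuration. -/
noncomputable def disp (i j : Fin n) : Config n →L[ℝ] EuclideanSpace ℝ (Fin 2) :=
  LinearMap.toContinuousLinearMap
    { toFun := fun z => pos z i - pos z j
      map_add' := fun z w => by
        ext k; fin_cases k <;> simp [pos] <;> ring
      map_smul' := fun c z => by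
        ext k; fin_cases k <;> simp [pos] <;> ring }

theorem disp_apply (i j : Fin n) (z : Config n) : disp i j z = pos z i - pos z j := rfl

/-- The clockwise quarter turn of the plane, the linear map of the matrix `J`. -/
noncomputable def turn : EuclideanSpace ℝ (Fin 2) →L[ℝ] EuclideanSpace ℝ (Fin 2) :=
  Matrix.toEuclideanCLM (𝕜 := ℝ) matJ

theorem turn_apply_zero (x : EuclideanSpace ℝ (Fin 2)) : turn x 0 = x 1 := by
  simp [turn, Matrix.ofLp_toEuclideanCLM, Matrix.mulVec, dotProduct, matJ]

theorem turn_apply_one (x : EuclideanSpace ℝ (Fin 2)) : turn x 1 = -x 0 := by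
  simp [turn, Matrix.ofLp_toEuclideanCLM, Matrix.mulVec, dotProduct, matJ]

theorem disp_opK (i j : Fin n) (z : Config n) : disp i j (opK n z) = turn (disp i j z) := by
  ext k
  fin_cases k <;>
    simp [disp_apply, pos, opK_apply_zero, opK_apply_one, turn_apply_zero, turn_apply_one]

theorem inner_turn_left (x y : EuclideanSpace ℝ (Fin 2)) :
    inner ℝ (turn x) y = -inner ℝ x (turn y) := by
  simp [PiLp.inner_apply, Fin.sum_univ_two, turn_apply_zero, turn_apply_one]

/-- The Hessian of the harmonic function `log ‖x‖` is symmetric and trace free, so it anticommutes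
with the quarter turn. -/
theorem logNormHess_turn (x u : EuclideanSpace ℝ (Fin 2)) :
    logNormHess x (turn u) = -turn (logNormHess x u) := by
  rcases eq_or_ne x 0 with rfl | hx
  · simp [logNormHess_apply]
  have hx2 : ‖x‖ ^ 2 ≠ 0 := by positivity
  have hn : ‖x‖ ^ 2 = x 0 ^ 2 + x 1 ^ 2 := by simp [EuclideanSpace.norm_sq_eq, Fin.sum_univ_two]
  rw [hn] at hx2
  ext k
  simp only [logNormHess_apply, hn]
  fin_cases k <;>
    simp [PiLp.inner_apply, Fin.sum_univ_two, turn_apply_zero, turn_apply_one] <;>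
    field_simp <;> ring

theorem CollisionFree.disp_ne_zero {z : Config n} (hz : CollisionFree z) {i j : Fin n}
    (hij : i ≠ j) : disp i j z ≠ 0 := sub_ne_zero.2 (hz i j hij)

theorem isOpen_collisionFree : IsOpen {z : Config n | CollisionFree z} := by
  have h : {z : Config n | CollisionFree z} =
      ⋂ i : Fin n, ⋂ j : Fin n, {z | i ≠ j → disp i j z ≠ 0} := by
    ext z
    simp [CollisionFree, disp_apply, sub_eq_zero]
  rw [h]
  refine isOpen_iInter_of_finite fun i => isOpen_iInter_of_finite fun j => ?_
  by_cases hij : i = j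
  · simp [hij]
  · simpa [hij] using! isOpen_ne.preimage (disp i j).continuous

/-! ### Gradient and Hessian of the Hamiltonian -/

theorem hamiltonian_eq (Γ : Fin n → ℝ) (z : Config n) : hamiltonian Γ z =
    -∑ i, ∑ j ∈ Finset.Ioi i, Γ i * Γ j * Real.log ‖disp i j z‖ := rfl

/-- The gradient of the Hamiltonian, written out: `- ∑_{i<j} Γ_i Γ_j D*_ij (x_ij / ‖x_ij‖²)` with
`x_ij = D_ij z = z_i - z_j`. It is the gradient only at collision-free configurations. -/
noncomputable def hamGrad (Γ : Fin n → ℝ) (z : Config n) : Config n :=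
  -∑ i, ∑ j ∈ Finset.Ioi i, (Γ i * Γ j) • (disp i j).adjoint (logNormGrad (disp i j z))

theorem hasGradientAt_hamiltonian (Γ : Fin n → ℝ) {z : Config n} (hz : CollisionFree z) :
    HasGradientAt (hamiltonian Γ) (hamGrad Γ z) z := by
  rw [hasGradientAt_iff_hasFDerivAt]
  have h : HasFDerivAt (hamiltonian Γ) (-∑ i, ∑ j ∈ Finset.Ioi i,
      (Γ i * Γ j) • (innerSL ℝ (logNormGrad (disp i j z)) ∘L disp i j)) z := by
    refine (HasFDerivAt.fun_sum fun i _ => HasFDerivAt.fun_sum fun j hj => ?_).neg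
    exact ((hasFDerivAt_log_norm (hz.disp_ne_zero (Finset.mem_Ioi.1 hj).ne)).comp z
      (disp i j).hasFDerivAt).const_mul _
  refine h.congr_fderiv ?_
  ext w
  simp [hamGrad, ContinuousLinearMap.adjoint_inner_left]

theorem gradient_hamiltonian (Γ : Fin n → ℝ) {z : Config n} (hz : CollisionFree z) :
    gradient (hamiltonian Γ) z = hamGrad Γ z := (hasGradientAt_hamiltonian Γ hz).gradient

theorem hasFDerivAt_hamGrad (Γ : Fin n → ℝ) {z : Config n} (hz : CollisionFree z) :
    HasFDerivAt (hamGrad Γ) (-∑ i, ∑ j ∈ Finset.Ioi i,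
      (Γ i * Γ j) • ((disp i j).adjoint ∘L logNormHess (disp i j z) ∘L disp i j)) z := by
  refine (HasFDerivAt.fun_sum fun i _ => HasFDerivAt.fun_sum fun j hj => ?_).neg
  have h : HasFDerivAt (fun w => (disp i j).adjoint (logNormGrad (disp i j w)))
      ((disp i j).adjoint ∘L logNormHess (disp i j z) ∘L disp i j) z :=
    (disp i j).adjoint.hasFDerivAt.comp z
      ((hasFDerivAt_logNormGrad (hz.disp_ne_zero (Finset.mem_Ioi.1 hj).ne)).comp z
        (disp i j).hasFDerivAt)
  exact h.const_smul (Γ i * Γ j)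

theorem hasFDerivAt_gradient_hamiltonian (Γ : Fin n → ℝ) {z : Config n} (hz : CollisionFree z) :
    HasFDerivAt (gradient (hamiltonian Γ)) (hessian Γ z) z := by
  have h := (hasFDerivAt_hamGrad Γ hz).congr_of_eventuallyEq
    (f₁ := gradient (hamiltonian Γ)) (by
      filter_upwards [isOpen_collisionFree.mem_nhds hz] with w hw
      exact gradient_hamiltonian Γ hw)
  exact h.differentiableAt.hasFDerivAt

theorem hessian_apply (Γ : Fin n → ℝ) {z : Config n} (hz : CollisionFree z) (w : Config n) :
    hessian Γ z w = -∑ i, ∑ j ∈ Finset.Ioi i,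
      (Γ i * Γ j) • (disp i j).adjoint (logNormHess (disp i j z) (disp i j w)) := by
  have h := (hasFDerivAt_hamGrad Γ hz).congr_of_eventuallyEq
    (f₁ := gradient (hamiltonian Γ)) (by
      filter_upwards [isOpen_collisionFree.mem_nhds hz] with w hw
      exact gradient_hamiltonian Γ hw)
  rw [hessian, h.fderiv]
  simp

theorem inner_hessian_left (Γ : Fin n → ℝ) {z : Config n} (hz : CollisionFree z)
    (v w : Config n) : inner ℝ (hessian Γ z v) w = inner ℝ v (hessian Γ z w) := by
  simp only [hessian_apply Γ hz, inner_neg_left, inner_neg_right, sum_inner, inner_sum,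
    real_inner_smul_left, real_inner_smul_right, ContinuousLinearMap.adjoint_inner_left,
    ContinuousLinearMap.adjoint_inner_right, inner_logNormHess_left]

theorem hessian_opK (Γ : Fin n → ℝ) {z : Config n} (hz : CollisionFree z) (w : Config n) :
    hessian Γ z (opK n w) = -opK n (hessian Γ z w) := by
  refine ext_inner_right ℝ fun v => ?_
  rw [inner_neg_left, inner_opK_left, neg_neg]
  simp only [hessian_apply Γ hz, inner_neg_left, sum_inner,
    real_inner_smul_left, ContinuousLinearMap.adjoint_inner_left, disp_opK, logNormHess_turn,
    inner_turn_left, neg_neg]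

/-- Euler's identity for the gradient of the Hamiltonian, which is homogeneous of degree `-1`. -/
theorem hessian_self (Γ : Fin n → ℝ) {z : Config n} (hz : CollisionFree z) :
    hessian Γ z z = -gradient (hamiltonian Γ) z := by
  rw [gradient_hamiltonian Γ hz, hessian_apply Γ hz, hamGrad]
  simp [logNormHess_self]

theorem inner_gradient_self_neg (hn : 2 ≤ n) {Γ : Fin n → ℝ} (hΓ : ∀ i, 0 < Γ i) {z : Config n}
    (hz : CollisionFree z) : inner ℝ (gradient (hamiltonian Γ) z) z < 0 := by
  have h : inner ℝ (gradient (hamiltonian Γ) z) z = -∑ i, ∑ j ∈ Finset.Ioi i, Γ i * Γ j := by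
    rw [gradient_hamiltonian Γ hz, hamGrad]
    simp only [inner_neg_left, sum_inner, real_inner_smul_left,
      ContinuousLinearMap.adjoint_inner_left]
    refine congrArg _ (Finset.sum_congr rfl fun i _ => Finset.sum_congr rfl fun j hj => ?_)
    rw [inner_logNormGrad_self (hz.disp_ne_zero (Finset.mem_Ioi.1 hj).ne), mul_one]
  have hp : ∀ i j, 0 < Γ i * Γ j := fun i j => mul_pos (hΓ i) (hΓ j)
  rw [h, neg_lt_zero]
  refine Finset.sum_pos' (fun i _ => Finset.sum_nonneg fun j _ => (hp i j).le)
    ⟨⟨0, by omega⟩, Finset.mem_univ _, Finset.sum_pos (fun j _ => hp _ j) ⟨⟨1, by omega⟩, ?_⟩⟩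
  simp

theorem contDiffAt_hamiltonian (Γ : Fin n → ℝ) {z : Config n} (hz : CollisionFree z) {k : ℕ∞} :
    ContDiffAt ℝ k (hamiltonian Γ) z := by
  refine ContDiffAt.neg (ContDiffAt.sum fun i _ => ContDiffAt.sum fun j hj => ?_)
  have h := hz.disp_ne_zero (Finset.mem_Ioi.1 hj).ne
  exact contDiffAt_const.mul (((disp i j).contDiff.contDiffAt.norm ℝ h).log (norm_ne_zero_iff.2 h))

theorem norm_disp_rot (i j : Fin n) (a : ℝ) (z : Config n) :
    ‖disp i j (rot a z)‖ = ‖disp i j z‖ := by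
  have h : disp i j (rot a z) = Real.cos a • disp i j z + Real.sin a • turn (disp i j z) := by
    rw [rot, map_add, map_smul, map_smul, disp_opK]
  rw [h, ← pow_left_inj₀ (norm_nonneg _) (norm_nonneg _) two_ne_zero]
  simp only [EuclideanSpace.norm_sq_eq, Fin.sum_univ_two, PiLp.add_apply, PiLp.smul_apply,
    turn_apply_zero, turn_apply_one, smul_eq_mul, Real.norm_eq_abs, sq_abs]
  linear_combination (disp i j z 0 ^ 2 + disp i j z 1 ^ 2) * Real.sin_sq_add_cos_sq a

theorem hamiltonian_rot (Γ : Fin n → ℝ) (a : ℝ) (z : Config n) :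
    hamiltonian Γ (rot a z) = hamiltonian Γ z := by
  simp only [hamiltonian_eq, norm_disp_rot]

theorem collisionFree_rot {z : Config n} (hz : CollisionFree z) (a : ℝ) :
    CollisionFree (rot a z) := fun i j hij => by
  have h := hz.disp_ne_zero hij
  rwa [← norm_ne_zero_iff, ← norm_disp_rot i j a, norm_ne_zero_iff, disp_apply, sub_ne_zero] at h

/-! ### Generalized eigenvectors by minimization -/

section Rayleigh

variable {E : Type*} [NormedAddCommGroup E] [InnerProductSpace ℝ E] [FiniteDimensional ℝ E]

/-- The Rayleigh quotient `⟨w, T w⟩ / ⟨w, M w⟩` attains its minimum on the `M`-orthogonal complement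
of a vector `k` in the kernel of `T`, and a minimizer is an eigenvector of the pencil `T - c M`
on the whole space. -/
theorem exists_eigenvector_le_rayleigh {T M : E →L[ℝ] E}
    (hT : ∀ v w, inner ℝ (T v) w = inner ℝ v (T w))
    (hM : ∀ v w, inner ℝ (M v) w = inner ℝ v (M w))
    (hMpos : ∀ w ≠ 0, 0 < inner ℝ w (M w)) {k : E} (hk : k ≠ 0) (hTk : T k = 0)
    {w₀ : E} (hw₀ : w₀ ≠ 0) (hw₀k : inner ℝ w₀ (M k) = 0) :
    ∃ (c : ℝ) (w : E), w ≠ 0 ∧ inner ℝ w (M k) = 0 ∧ T w = c • M w ∧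
      c * inner ℝ w₀ (M w₀) ≤ inner ℝ w₀ (T w₀) := by
  let S : Set E := Metric.sphere 0 1 ∩ {w | inner ℝ w (M k) = 0}
  have hS : IsCompact S :=
    (isCompact_sphere 0 1).inter_right (isClosed_eq (by fun_prop) continuous_const)
  have hnormalize : ∀ w : E, w ≠ 0 → inner ℝ w (M k) = 0 → ‖w‖⁻¹ • w ∈ S := fun w hw hwk => by
    refine ⟨?_, ?_⟩
    · simp [norm_smul, hw]
    · simp [real_inner_smul_left, hwk]
  have hne : ∀ w ∈ S, w ≠ 0 := fun w hw h => by
    have := hw.1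
    simp [h] at this
  obtain ⟨w, hwS, hmin⟩ := hS.exists_isMinOn ⟨_, hnormalize w₀ hw₀ hw₀k⟩
    (f := fun w => inner ℝ w (T w) / inner ℝ w (M w))
    (ContinuousOn.div (by fun_prop) (by fun_prop) fun w hw => (hMpos w (hne w hw)).ne')
  have hw0 := hne w hwS
  have hwk : inner ℝ w (M k) = 0 := hwS.2
  set c := inner ℝ w (T w) / inner ℝ w (M w) with hc
  have hle : ∀ v, inner ℝ v (M k) = 0 → c * inner ℝ v (M v) ≤ inner ℝ v (T v) := fun v hvk => by
    rcases eq_or_ne v 0 with rfl | hv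
    · simp
    have h := hmin (hnormalize v hv hvk)
    simp only [Set.mem_ofPred_eq, map_smul, real_inner_smul_left, real_inner_smul_right] at h
    rw [← hc, ← mul_assoc, ← mul_assoc, mul_div_mul_left _ _ (by positivity),
      le_div_iff₀ (hMpos v hv)] at h
    exact h
  refine ⟨c, w, hw0, hwk, ?_, hle w₀ hw₀k⟩
  have hww : inner ℝ w (T w) = c * inner ℝ w (M w) :=
    (div_mul_cancel₀ _ (hMpos w hw0).ne').symm
  -- the form of `T - c M` is nonnegative on the complement of `k` and vanishes at `w`
  have horth : ∀ v, inner ℝ v (M k) = 0 → inner ℝ v (T w - c • M w) = 0 := fun v hvk => by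
    have hq : ∀ t : ℝ, 0 ≤ (inner ℝ v (T v) - c * inner ℝ v (M v)) * (t * t)
        + 2 * inner ℝ v (T w - c • M w) * t + 0 := fun t => by
      have h := hle (w + t • v) (by simp [inner_add_left, real_inner_smul_left, hwk, hvk])
      have h1 : inner ℝ w (T v) = inner ℝ v (T w) := by rw [← hT, real_inner_comm]
      have h2 : inner ℝ w (M v) = inner ℝ v (M w) := by rw [← hM, real_inner_comm]
      simp only [map_add, map_smul, inner_add_left, inner_add_right, real_inner_smul_left,
        real_inner_smul_right, h1, h2, hww] at h
      simp only [inner_sub_right, real_inner_smul_right]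
      linarith
    have h := discrim_le_zero hq
    simp only [discrim] at h
    nlinarith
  rw [← sub_eq_zero]
  refine ext_inner_left ℝ fun v => ?_
  have hkk := (hMpos k hk).ne'
  have hv := horth (v - (inner ℝ v (M k) / inner ℝ k (M k)) • k) (by
    rw [inner_sub_left, real_inner_smul_left, div_mul_cancel₀ _ hkk, sub_self])
  have hkT : inner ℝ k (T w) = 0 := by rw [← hT, hTk, inner_zero_left]
  have hkM : inner ℝ k (M w) = 0 := by rw [← hM, real_inner_comm, hwk]
  rw [inner_sub_left, real_inner_smul_left, inner_sub_right k, real_inner_smul_right, hkT, hkM,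
    mul_zero, sub_zero, mul_zero, sub_zero] at hv
  rw [hv, inner_zero_right]

/-- A quadratic form that is positive on the nonzero vectors orthogonal to `k` is coercive there. -/
theorem exists_coercive {T : E →L[ℝ] E} {k : E}
    (hpos : ∀ w, w ≠ 0 → inner ℝ w k = 0 → 0 < inner ℝ w (T w)) :
    ∃ c > 0, ∀ w, inner ℝ w k = 0 → c * ‖w‖ ^ 2 ≤ inner ℝ w (T w) := by
  let S : Set E := Metric.sphere 0 1 ∩ {w | inner ℝ w k = 0}
  have hS : IsCompact S :=
    (isCompact_sphere 0 1).inter_right (isClosed_eq (by fun_prop) continuous_const)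
  have hne : ∀ w ∈ S, w ≠ 0 := fun w hw h => by
    have := hw.1
    simp [h] at this
  obtain ⟨c, hc, hcS⟩ := hS.exists_forall_le' (f := fun w => inner ℝ w (T w)) (by fun_prop)
    (a := 0) fun w hw => hpos w (hne w hw) hw.2
  refine ⟨c, hc, fun w hwk => ?_⟩
  rcases eq_or_ne w 0 with rfl | hw
  · simp
  have h := hcS (‖w‖⁻¹ • w) ⟨by simp [norm_smul, hw], by simp [real_inner_smul_left, hwk]⟩
  rw [map_smul, real_inner_smul_left, real_inner_smul_right, ← mul_assoc, ← mul_inv,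
    ← div_eq_inv_mul, le_div_iff₀ (by positivity)] at h
  rwa [pow_two]

end Rayleigh

/-! ### Relative equilibria -/

theorem IsRelativeEquilibrium.collisionFree {Γ : Fin n → ℝ} {ω : ℝ} {z₀ : Config n}
    (h : IsRelativeEquilibrium Γ ω z₀) : CollisionFree z₀ := by
  simpa [rot_zero] using (h.2 0 trivial).1

/-- A relative equilibrium is a critical point of `H + ω/2 ⟨z, M z⟩`. -/
theorem IsRelativeEquilibrium.gradient_eq {Γ : Fin n → ℝ} {ω : ℝ} {z₀ : Config n}
    (h : IsRelativeEquilibrium Γ ω z₀) :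
    gradient (hamiltonian Γ) z₀ = -(ω • opM Γ z₀) := by
  obtain ⟨-, v, hv, hMv⟩ := h.2 0 trivial
  have h1 : HasDerivAt (fun t => rot (-ω * t) z₀) (-ω • opK n z₀) 0 := by
    have h2 : HasDerivAt (fun t : ℝ => -ω * t) (-ω) 0 := by
      simpa using (hasDerivAt_id (0 : ℝ)).const_mul (-ω)
    have h3 := (hasDerivAt_rot z₀ (-ω * 0)).scomp (0 : ℝ) h2
    rw [mul_zero, rot_zero] at h3
    exact h3
  rw [hv.unique h1] at hMv
  simp only [mul_zero, rot_zero, zero_smul, add_zero, map_smul, opM_opK] at hMv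
  apply opK_injective
  rw [← hMv]
  simp

theorem IsRelativeEquilibrium.ne_zero (hn : 2 ≤ n) {Γ : Fin n → ℝ} {ω : ℝ} {z₀ : Config n}
    (h : IsRelativeEquilibrium Γ ω z₀) : z₀ ≠ 0 := by
  rintro rfl
  exact h.collisionFree ⟨0, by omega⟩ ⟨1, by omega⟩ (by simp) (by simp [pos])

theorem IsRelativeEquilibrium.omega_pos (hn : 2 ≤ n) {Γ : Fin n → ℝ} (hΓ : ∀ i, 0 < Γ i) {ω : ℝ}
    {z₀ : Config n} (h : IsRelativeEquilibrium Γ ω z₀) : 0 < ω := by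
  have h1 := inner_gradient_self_neg hn hΓ h.collisionFree
  rw [h.gradient_eq, inner_neg_left, real_inner_smul_left, inner_opM_left, neg_lt_zero] at h1
  exact pos_of_mul_pos_left h1 (inner_opM_self_pos hΓ (h.ne_zero hn)).le

theorem IsRelativeEquilibrium.hessian_self {Γ : Fin n → ℝ} {ω : ℝ} {z₀ : Config n}
    (h : IsRelativeEquilibrium Γ ω z₀) : hessian Γ z₀ z₀ = ω • opM Γ z₀ := by
  rw [PointVortex.hessian_self Γ h.collisionFree, h.gradient_eq, neg_neg]

theorem IsRelativeEquilibrium.hessian_opK_self {Γ : Fin n → ℝ} {ω : ℝ} {z₀ : Config n}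
    (h : IsRelativeEquilibrium Γ ω z₀) :
    hessian Γ z₀ (opK n z₀) = -(ω • opM Γ (opK n z₀)) := by
  rw [hessian_opK Γ h.collisionFree, h.hessian_self, map_smul, opM_opK]

/-! ### The stability matrix -/

theorem stabilityOp_apply (Γ : Fin n → ℝ) (ω : ℝ) (z₀ w : Config n) :
    stabilityOp Γ ω z₀ w = opK n (opMinv Γ (hessian Γ z₀ w) + ω • w) := by
  simp [stabilityOp]

/-- Since `M⁻¹ D²H` anticommutes with `K`, the square of `B = K (M⁻¹ D²H + ω)` is
`(M⁻¹ D²H)² - ω²`. -/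
theorem stabilityOp_stabilityOp (Γ : Fin n → ℝ) (ω : ℝ) {z₀ : Config n} (hz₀ : CollisionFree z₀)
    (w : Config n) : stabilityOp Γ ω z₀ (stabilityOp Γ ω z₀ w) =
      opMinv Γ (hessian Γ z₀ (opMinv Γ (hessian Γ z₀ w))) - ω ^ 2 • w := by
  simp only [stabilityOp_apply, hessian_opK Γ hz₀, map_add, map_neg, map_smul, opMinv_opK, opK_opK]
  module

theorem IsRelativeEquilibrium.stabilityOp_stabilityOp_self {Γ : Fin n → ℝ} (hΓ : ∀ i, 0 < Γ i)
    {ω : ℝ} {z₀ : Config n} (h : IsRelativeEquilibrium Γ ω z₀) :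
    stabilityOp Γ ω z₀ (stabilityOp Γ ω z₀ z₀) = 0 := by
  simp only [stabilityOp_stabilityOp Γ ω h.collisionFree, h.hessian_self, map_smul, opMinv_opM hΓ]
  module

theorem IsRelativeEquilibrium.stabilityOp_stabilityOp_opK_self {Γ : Fin n → ℝ}
    (hΓ : ∀ i, 0 < Γ i) {ω : ℝ} {z₀ : Config n} (h : IsRelativeEquilibrium Γ ω z₀) :
    stabilityOp Γ ω z₀ (stabilityOp Γ ω z₀ (opK n z₀)) = 0 := by
  simp only [stabilityOp_stabilityOp Γ ω h.collisionFree, h.hessian_opK_self, map_neg, map_smul,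
    opMinv_opM hΓ]
  module

theorem mem_subVperp_iff {Γ : Fin n → ℝ} {z₀ w : Config n} : w ∈ subVperp Γ z₀ ↔
    inner ℝ w (opM Γ z₀) = 0 ∧ inner ℝ w (opM Γ (opK n z₀)) = 0 := by
  constructor
  · intro h
    exact ⟨h _ (Submodule.subset_span (by simp)), h _ (Submodule.subset_span (by simp))⟩
  · rintro ⟨h1, h2⟩ v hv
    obtain ⟨a, b, rfl⟩ := Submodule.mem_span_pair.1 hv
    simp [inner_add_right, real_inner_smul_right, h1, h2]

/-- Nondegeneracy bounds the multiplicity of the eigenvalue `0` by that of the trivial ones. -/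
theorem rootMultiplicity_charpoly_stabilityOp_le {Γ : Fin n → ℝ} {ω : ℝ} (hω : ω ≠ 0)
    {z₀ : Config n} (h : IsNondegenerate Γ ω z₀) :
    (stabilityOp Γ ω z₀ : Config n →ₗ[ℝ] Config n).charpoly.rootMultiplicity 0 ≤ 2 := by
  by_contra! hlt
  refine h 0 ?_ rfl
  have hω' : (ω : ℂ) * Complex.I ≠ 0 := by simp [hω]
  rw [nontrivialEigenvalues, ← Multiset.count_pos, Multiset.count_sub, Polynomial.aroots,
    Polynomial.count_roots]
  have h1 := Polynomial.eq_rootMultiplicity_map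
    (p := (stabilityOp Γ ω z₀ : Config n →ₗ[ℝ] Config n).charpoly)
    (f := algebraMap ℝ ℂ) (algebraMap ℝ ℂ).injective 0
  rw [map_zero] at h1
  rw [← h1]
  have h2 : Multiset.count (0 : ℂ)
      {0, 0, (ω : ℂ) * Complex.I, -((ω : ℂ) * Complex.I)} = 2 := by
    simp [Multiset.insert_eq_cons, hω]
  omega

/-- `z₀` and `K z₀` already exhaust the generalized kernel of `B`. -/
theorem eq_zero_of_stabilityOp_stabilityOp_eq_zero {Γ : Fin n → ℝ} (hΓ : ∀ i, 0 < Γ i) {ω : ℝ}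
    {z₀ : Config n} (hne : z₀ ≠ 0) (hz₀ : IsRelativeEquilibrium Γ ω z₀)
    (h : IsNondegenerate Γ ω z₀) {w : Config n} (hw : w ∈ subVperp Γ z₀)
    (hBw : stabilityOp Γ ω z₀ (stabilityOp Γ ω z₀ w) = 0) : w = 0 := by
  by_contra hw0
  rw [mem_subVperp_iff] at hw
  let B : Module.End ℝ (Config n) := (stabilityOp Γ ω z₀ : Config n →ₗ[ℝ] Config n)
  let G := B.maxGenEigenspace 0
  have hG : ∀ v, stabilityOp Γ ω z₀ (stabilityOp Γ ω z₀ v) = 0 → v ∈ G := fun v hv => by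
    rw [Module.End.mem_maxGenEigenspace]
    exact ⟨2, by simpa [pow_two, B] using hv⟩
  -- three independent vectors would exceed the multiplicity two of the eigenvalue `0`
  let f : Fin 3 → G := ![⟨z₀, hG _ (hz₀.stabilityOp_stabilityOp_self hΓ)⟩,
    ⟨opK n z₀, hG _ (hz₀.stabilityOp_stabilityOp_opK_self hΓ)⟩, ⟨w, hG _ hBw⟩]
  have hf : LinearIndependent ℝ f := by
    rw [Fintype.linearIndependent_iff]
    intro g hg
    have hsum : g 0 • z₀ + g 1 • opK n z₀ + g 2 • w = 0 := by
      simpa [f, Fin.sum_univ_three] using congrArg (Subtype.val) hg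
    have hK : opK n z₀ ≠ 0 := fun hc => hne (opK_injective (hc.trans (map_zero _).symm))
    have e1 : inner ℝ z₀ (opM Γ (opK n z₀)) = 0 := by
      rw [← inner_opM_left, real_inner_comm, inner_opK_opM]
    have h0 : g 0 = 0 := by
      have := congrArg (fun v => inner ℝ v (opM Γ z₀)) hsum
      simpa [inner_add_left, real_inner_smul_left, inner_opK_opM, hw.1,
        (inner_opM_self_pos hΓ hne).ne'] using this
    have h1 : g 1 = 0 := by
      have := congrArg (fun v => inner ℝ v (opM Γ (opK n z₀))) hsum
      simpa [inner_add_left, real_inner_smul_left, e1, hw.2,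
        (inner_opM_self_pos hΓ hK).ne'] using this
    have h2 : g 2 = 0 := by simpa [h0, h1, hw0] using hsum
    intro i
    fin_cases i
    exacts [h0, h1, h2]
  have hcard := hf.fintype_card_le_finrank
  have hfin : Module.finrank ℝ G = B.charpoly.rootMultiplicity 0 :=
    LinearMap.finrank_maxGenEigenspace_eq B 0
  have : B.charpoly.rootMultiplicity 0 ≤ 2 :=
    rootMultiplicity_charpoly_stabilityOp_le hz₀.1 h
  simp only [Fintype.card_fin] at hcard
  omega

/-- On the `M`-orthogonal complement of `V` the block form makes `B²` diagonal with entries `-β_j²`,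
and nondegeneracy excludes the value `0`. -/
theorem eigenvalue_sq_neg {Γ : Fin n → ℝ} (hΓ : ∀ i, 0 < Γ i) {ω : ℝ}
    {z₀ : Config n} (hne : z₀ ≠ 0) (hz₀ : IsRelativeEquilibrium Γ ω z₀)
    (h : IsLinearlyStable Γ ω z₀) {u : Config n} (hu : u ∈ subVperp Γ z₀) (hu0 : u ≠ 0) {κ : ℝ}
    (hBu : stabilityOp Γ ω z₀ (stabilityOp Γ ω z₀ u) = κ • u) : κ < 0 := by
  obtain ⟨⟨hnd, -⟩, m, b, β, hb⟩ := h
  have hκ : κ ≠ 0 := by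
    rintro rfl
    exact hu0 (eq_zero_of_stabilityOp_stabilityOp_eq_zero hΓ hne hz₀ hnd hu (by simpa using hBu))
  have hBb : ∀ p, stabilityOp Γ ω z₀ (stabilityOp Γ ω z₀ (b p)) =
      (-β p.1 ^ 2) • (b p : Config n) := by
    rintro ⟨j, k⟩
    obtain ⟨h0, h1⟩ := hb j
    fin_cases k
    · simp only [Fin.mk_zero, h0, map_smul, h1]
      module
    · simp only [Fin.mk_one, h1, map_smul, h0]
      module
  let c := b.repr ⟨u, hu⟩
  have hsum : ∑ p, c p • (b p : Config n) = u := by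
    simpa only [Submodule.coe_sum, Submodule.coe_smul] using
      congrArg Subtype.val (b.sum_repr ⟨u, hu⟩)
  have hrel : ∀ p, c p * (κ + β p.1 ^ 2) = 0 := by
    refine Fintype.linearIndependent_iff.1 b.linearIndependent _ (Subtype.ext ?_)
    rw [← hsum] at hBu
    simp only [map_sum, map_smul, hBb, Finset.smul_sum] at hBu
    have hz := sub_eq_zero.2 hBu.symm
    rw [← Finset.sum_sub_distrib] at hz
    push_cast
    rw [← hz]
    exact Finset.sum_congr rfl fun p _ => by module
  obtain ⟨p, hp⟩ : ∃ p, c p ≠ 0 := by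
    by_contra! hc
    exact hu0 (by rw [← hsum]; simp [hc])
  have := (mul_eq_zero.1 (hrel p)).resolve_left hp
  have h2 := sq_nonneg (β p.1)
  exact lt_of_le_of_ne (by linarith) hκ

/-! ### The second variation -/

/-- The Hessian `D²H(z₀) + ω M` of the Hamiltonian in the rotating frame. -/
noncomputable def secondVariation (Γ : Fin n → ℝ) (ω : ℝ) (z₀ : Config n) :
    Config n →L[ℝ] Config n :=
  hessian Γ z₀ + ω • opM Γ

theorem secondVariation_apply (Γ : Fin n → ℝ) (ω : ℝ) (z₀ w : Config n) :
    secondVariation Γ ω z₀ w = hessian Γ z₀ w + ω • opM Γ w := rfl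

/-- Away from the direction `K z₀` of the orbit, the eigenvalues of `M⁻¹ D²H + ω` are positive:
on `V`, the only other one is `2ω`, and on the complement of `V` an eigenvalue `c` gives the
eigenvalue `(c - ω)² - ω²` of `B²`, which is negative. -/
theorem eigenvalue_secondVariation_pos {Γ : Fin n → ℝ} (hΓ : ∀ i, 0 < Γ i) {ω : ℝ} (hω : 0 < ω)
    {z₀ : Config n} (hne : z₀ ≠ 0) (hz₀ : IsRelativeEquilibrium Γ ω z₀)
    (h : IsLinearlyStable Γ ω z₀) {w : Config n} (hw0 : w ≠ 0)
    (hwK : inner ℝ w (opM Γ (opK n z₀)) = 0) {c : ℝ}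
    (hw : secondVariation Γ ω z₀ w = c • opM Γ w) : 0 < c := by
  have hH : hessian Γ z₀ w = (c - ω) • opM Γ w := by
    rw [secondVariation_apply] at hw
    rw [sub_smul, ← hw, add_sub_cancel_right]
  by_cases hz : inner ℝ w (opM Γ z₀) = 0
  · have hneg := eigenvalue_sq_neg hΓ hne hz₀ h (mem_subVperp_iff.2 ⟨hz, hwK⟩) hw0
      (κ := (c - ω) ^ 2 - ω ^ 2) (by
        simp only [stabilityOp_stabilityOp Γ ω hz₀.collisionFree, hH, map_smul, opMinv_opM hΓ]
        module)
    nlinarith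
  · have h1 := inner_hessian_left Γ hz₀.collisionFree w z₀
    rw [hH, hz₀.hessian_self, real_inner_smul_left, real_inner_smul_right, inner_opM_left] at h1
    have := mul_right_cancel₀ hz h1
    linarith

theorem secondVariation_opK_self {Γ : Fin n → ℝ} {ω : ℝ} {z₀ : Config n}
    (h : IsRelativeEquilibrium Γ ω z₀) : secondVariation Γ ω z₀ (opK n z₀) = 0 := by
  rw [secondVariation_apply, h.hessian_opK_self, neg_add_cancel]

theorem inner_secondVariation_left (Γ : Fin n → ℝ) (ω : ℝ) {z₀ : Config n}
    (hz₀ : CollisionFree z₀) (v w : Config n) :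
    inner ℝ (secondVariation Γ ω z₀ v) w = inner ℝ v (secondVariation Γ ω z₀ w) := by
  simp only [secondVariation_apply, inner_add_left, inner_add_right, real_inner_smul_left,
    real_inner_smul_right, inner_hessian_left Γ hz₀, inner_opM_left]

/-- Linear stability makes the second variation positive definite across the orbit `γ`. -/
theorem exists_secondVariation_coercive {Γ : Fin n → ℝ} (hΓ : ∀ i, 0 < Γ i) {ω : ℝ} (hω : 0 < ω)
    {z₀ : Config n} (hne : z₀ ≠ 0) (hz₀ : IsRelativeEquilibrium Γ ω z₀)
    (h : IsLinearlyStable Γ ω z₀) :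
    ∃ c > 0, ∀ w, inner ℝ w (opK n z₀) = 0 →
      c * ‖w‖ ^ 2 ≤ inner ℝ w (secondVariation Γ ω z₀ w) := by
  refine exists_coercive fun w hw0 hwK => ?_
  have hK : opK n z₀ ≠ 0 := fun hc => hne (opK_injective (hc.trans (map_zero _).symm))
  have hKK := (inner_opM_self_pos hΓ hK).ne'
  have hTK := secondVariation_opK_self hz₀
  have hsymm := inner_secondVariation_left Γ ω hz₀.collisionFree
  -- the component of `w` that is `M`-orthogonal to `K z₀` has the same second variation
  set a := inner ℝ w (opM Γ (opK n z₀)) / inner ℝ (opK n z₀) (opM Γ (opK n z₀))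
  set u := w - a • opK n z₀ with hu
  have huK : inner ℝ u (opM Γ (opK n z₀)) = 0 := by
    rw [hu, inner_sub_left, real_inner_smul_left, div_mul_cancel₀ _ hKK, sub_self]
  have hu0 : u ≠ 0 := by
    intro hc
    have hwa : w = a • opK n z₀ := sub_eq_zero.1 hc
    have h1 := hwK
    rw [hwa, real_inner_smul_left, real_inner_self_eq_norm_sq] at h1
    have ha : a = 0 := (mul_eq_zero.1 h1).resolve_right (by positivity)
    exact hw0 (by rw [hwa, ha, zero_smul])
  have hTu : inner ℝ w (secondVariation Γ ω z₀ w) = inner ℝ u (secondVariation Γ ω z₀ u) := by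
    rw [hu, map_sub, map_smul, hTK, smul_zero, sub_zero, inner_sub_left, real_inner_smul_left,
      ← hsymm (opK n z₀), hTK, inner_zero_left, mul_zero, sub_zero]
  obtain ⟨c, v, hv0, hvK, hv, hle⟩ := exists_eigenvector_le_rayleigh hsymm (inner_opM_left Γ)
    (fun w hw => inner_opM_self_pos hΓ hw) hK hTK hu0 huK
  have hc := eigenvalue_secondVariation_pos hΓ hω hne hz₀ h hv0 hvK hv
  rw [hTu]
  exact (mul_pos hc (inner_opM_self_pos hΓ hu0)).trans_le hle

/-! ### The energy in the rotating frame near the orbit -/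

/-- A critical point with coercive second derivative on the hyperplane orthogonal to `k` is a strict
minimum along that hyperplane, with quadratic growth. -/
theorem exists_quadratic_growth {E : Type*} [NormedAddCommGroup E] [InnerProductSpace ℝ E]
    [CompleteSpace E] {f : E → ℝ} {g : E → E} {z₀ k : E} {T : E →L[ℝ] E}
    (hf : ∀ᶠ z in nhds z₀, HasGradientAt f (g z) z) (hg₀ : g z₀ = 0) (hg : HasFDerivAt g T z₀)
    {c : ℝ} (hc : 0 < c) (hT : ∀ w, inner ℝ w k = 0 → c * ‖w‖ ^ 2 ≤ inner ℝ w (T w)) :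
    ∃ r > 0, ∀ z, ‖z - z₀‖ < r → inner ℝ (z - z₀) k = 0 →
      c / 4 * ‖z - z₀‖ ^ 2 ≤ f z - f z₀ := by
  -- an error of half the coercivity constant leaves `f` with quadratic growth
  have hlin : ∀ᶠ z in nhds z₀, ‖g z - T (z - z₀)‖ ≤ c / 2 * ‖z - z₀‖ := by
    have := hg.isLittleO.def (half_pos hc)
    simpa [hg₀] using this
  obtain ⟨r, hr, hball⟩ := Metric.eventually_nhds_iff.1 (hf.and hlin)
  refine ⟨r, hr, fun z hz hzk => ?_⟩
  set w := z - z₀ with hw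
  have hseg : ∀ t ∈ Set.Icc (0 : ℝ) 1, dist (z₀ + t • w) z₀ < r := fun t ht => by
    rw [dist_eq_norm, add_sub_cancel_left, norm_smul, Real.norm_eq_abs, abs_of_nonneg ht.1]
    exact (mul_le_of_le_one_left (norm_nonneg _) ht.2).trans_lt hz
  have hder : ∀ t ∈ Set.Icc (0 : ℝ) 1,
      HasDerivAt (fun t => f (z₀ + t • w) - c / 4 * ‖w‖ ^ 2 * t ^ 2)
        (inner ℝ (g (z₀ + t • w)) w - c / 4 * ‖w‖ ^ 2 * (2 * t)) t := fun t ht => by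
    have h1 : HasDerivAt (fun t : ℝ => z₀ + t • w) w t := by
      simpa using ((hasDerivAt_id t).smul_const w).const_add z₀
    have h2 := (hball (hseg t ht)).1.hasFDerivAt.comp_hasDerivAt t h1
    refine (h2.sub (((hasDerivAt_pow 2 t)).const_mul (c / 4 * ‖w‖ ^ 2))).congr_deriv ?_
    simp
  have hmono : MonotoneOn (fun t => f (z₀ + t • w) - c / 4 * ‖w‖ ^ 2 * t ^ 2) (Set.Icc 0 1) := by
    refine monotoneOn_of_deriv_nonneg (convex_Icc 0 1)
      (fun t ht => (hder t ht).continuousAt.continuousWithinAt)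
      (fun t ht => (hder t (interior_subset ht)).differentiableAt.differentiableWithinAt)
      fun t ht => ?_
    have ht' := interior_subset ht
    rw [(hder t ht').deriv]
    have h1 := (hball (hseg t ht')).2
    rw [add_sub_cancel_left, map_smul, norm_smul, Real.norm_eq_abs, abs_of_nonneg ht'.1] at h1
    have h2 : -(c / 2 * (t * ‖w‖) * ‖w‖) ≤ inner ℝ (g (z₀ + t • w) - t • T w) w := by
      refine le_trans (neg_le_neg ?_) (neg_le_of_abs_le (abs_real_inner_le_norm _ _))
      exact mul_le_mul_of_nonneg_right h1 (norm_nonneg _)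
    rw [inner_sub_left, real_inner_smul_left, real_inner_comm w (T w)] at h2
    have h3 := mul_le_mul_of_nonneg_left (hT w hzk) ht'.1
    nlinarith
  have h := hmono (by simp) (by simp) zero_le_one
  have hz1 : z₀ + w = z := by rw [hw]; abel
  simp only [zero_smul, add_zero, one_smul, hz1] at h
  linarith

/-- The Hamiltonian `H + ω/2 ⟨z, M z⟩` of the equations in the rotating frame. -/
noncomputable def energy (Γ : Fin n → ℝ) (ω : ℝ) (z : Config n) : ℝ :=
  hamiltonian Γ z + ω / 2 * inner ℝ z (opM Γ z)

theorem hasGradientAt_energy (Γ : Fin n → ℝ) (ω : ℝ) {z : Config n} (hz : CollisionFree z) :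
    HasGradientAt (energy Γ ω) (gradient (hamiltonian Γ) z + ω • opM Γ z) z := by
  rw [hasGradientAt_iff_hasFDerivAt]
  have h1 := (hasGradientAt_hamiltonian Γ hz).hasFDerivAt
  have h2 := ((hasFDerivAt_id z).inner ℝ (opM Γ).hasFDerivAt).const_mul (ω / 2)
  refine (h1.add h2).congr_fderiv ?_
  ext w
  rw [gradient_hamiltonian Γ hz]
  have h3 : inner ℝ w (opM Γ z) = inner ℝ (opM Γ z) w := real_inner_comm _ _
  simp [fderivInnerCLM_apply, h3, ← inner_opM_left Γ z w]
  ring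

theorem energy_rot (Γ : Fin n → ℝ) (ω a : ℝ) (z : Config n) :
    energy Γ ω (rot a z) = energy Γ ω z := by
  rw [energy, hamiltonian_rot, inner_rot_opM_rot, energy]

theorem contDiffAt_energy (Γ : Fin n → ℝ) (ω : ℝ) {z : Config n} (hz : CollisionFree z)
    {k : ℕ∞} : ContDiffAt ℝ k (energy Γ ω) z :=
  (contDiffAt_hamiltonian Γ hz).add
    (contDiffAt_const.mul (contDiffAt_id.inner ℝ (opM Γ).contDiff.contDiffAt))

/-- A configuration can be rotated so that its nearest point on the orbit `γ` is `z₀`; its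
displacement from `z₀` is then orthogonal to `γ`. -/
theorem exists_rot_nearest (z₀ z : Config n) :
    ∃ a, ‖rot a z - z₀‖ = Metric.infDist z (orbitCircle z₀) ∧
      inner ℝ (rot a z - z₀) (opK n z₀) = 0 := by
  obtain ⟨y, ⟨a, rfl⟩, hy⟩ :=
    (isCompact_orbitCircle z₀).exists_infDist_eq_dist ⟨_, Set.mem_range_self 0⟩ z
  have hdist : ∀ b, ‖rot (-a) z - rot b z₀‖ = dist z (rot (a + b) z₀) := fun b => by
    rw [dist_eq_norm, ← norm_rot (-a) (z - _), rot_sub, rot_rot, neg_add_cancel_left]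
  have h0 : ‖rot (-a) z - z₀‖ = Metric.infDist z (orbitCircle z₀) := by
    have := hdist 0
    rw [rot_zero, add_zero] at this
    rw [this, hy]
  refine ⟨-a, h0, ?_⟩
  have hder : HasDerivAt (fun b => ‖rot (-a) z - rot b z₀‖ ^ 2)
      (2 * inner ℝ (rot (-a) z - rot 0 z₀) (-opK n (rot 0 z₀))) 0 :=
    ((hasDerivAt_rot z₀ 0).const_sub _).norm_sq
  have hmin : IsLocalMin (fun b => ‖rot (-a) z - rot b z₀‖ ^ 2) 0 := by
    refine Filter.Eventually.of_forall fun b => pow_le_pow_left₀ (norm_nonneg _) ?_ 2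
    rw [rot_zero, h0, hdist]
    exact Metric.infDist_le_dist_of_mem (Set.mem_range_self _)
  have := hmin.hasDerivAt_eq_zero hder
  rw [rot_zero, inner_neg_right] at this
  linarith

/-- Near the orbit `γ`, the energy grows at least quadratically with the distance to `γ`. -/
theorem exists_energy_growth (hn : 2 ≤ n) {Γ : Fin n → ℝ} (hΓ : ∀ i, 0 < Γ i) {ω : ℝ}
    {z₀ : Config n} (hz₀ : IsRelativeEquilibrium Γ ω z₀) (h : IsLinearlyStable Γ ω z₀) :
    ∃ r > 0, ∃ c > 0, ∀ z, Metric.infDist z (orbitCircle z₀) < r →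
      CollisionFree z ∧
        c * Metric.infDist z (orbitCircle z₀) ^ 2 ≤ energy Γ ω z - energy Γ ω z₀ := by
  have hne := hz₀.ne_zero hn
  have hcf := hz₀.collisionFree
  obtain ⟨c, hc, hT⟩ := exists_secondVariation_coercive hΓ (hz₀.omega_pos hn hΓ) hne hz₀ h
  have hnhds := isOpen_collisionFree.mem_nhds hcf
  obtain ⟨r₁, hr₁, hgrow⟩ := exists_quadratic_growth (f := energy Γ ω)
    (g := fun z => gradient (hamiltonian Γ) z + ω • opM Γ z)
    (Filter.mem_of_superset hnhds fun z hz => hasGradientAt_energy Γ ω hz)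
    (by rw [hz₀.gradient_eq, neg_add_cancel])
    ((hasFDerivAt_gradient_hamiltonian Γ hcf).add ((opM Γ).hasFDerivAt.const_smul ω)) hc hT
  obtain ⟨r₂, hr₂, hball⟩ := Metric.mem_nhds_iff.1 hnhds
  refine ⟨min r₁ r₂, lt_min hr₁ hr₂, c / 4, by positivity, fun z hz => ?_⟩
  obtain ⟨a, ha, hak⟩ := exists_rot_nearest z₀ z
  constructor
  · have h1 : CollisionFree (rot a z) := hball (by
      rw [mem_ball_iff_norm, ha]
      exact hz.trans_le (min_le_right _ _))
    simpa [rot_neg_rot] using collisionFree_rot h1 (-a)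
  · have h1 := hgrow (rot a z) (by rw [ha]; exact hz.trans_le (min_le_left _ _)) hak
    rwa [ha, energy_rot] at h1

/-! ### Global solutions of differential equations -/

/-- A bounded Lipschitz vector field satisfies the hypotheses of the Picard-Lindelöf theorem on
every time interval, so that its integral curves exist for all time. -/
theorem exists_global_solution {E : Type*} [NormedAddCommGroup E] [NormedSpace ℝ E]
    [CompleteSpace E] {v : E → E} {C L : NNReal} (hv : LipschitzWith C v) (hb : ∀ x, ‖v x‖ ≤ L)
    (x : E) : ∃ φ : ℝ → E, φ 0 = x ∧ ∀ t, HasDerivAt φ (v (φ t)) t := by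
  have hloc : ∀ T : NNReal, ∃ α : ℝ → E, α 0 = x ∧
      ∀ t ∈ Set.Ioo (-T : ℝ) T, HasDerivAt α (v (α t)) t := fun T => by
    -- in time `T` a curve of speed at most `L` stays in the ball of radius `L * T`
    have h : IsPicardLindelof (fun _ => v) (tmin := -T) (tmax := T)
        ⟨0, by simp⟩ x (L * T) 0 L C :=
      IsPicardLindelof.of_time_independent (fun y _ => hb y) hv.lipschitzOnWith (by simp)
    obtain ⟨α, hα0, hα⟩ := h.exists_eq_forall_mem_Icc_hasDerivWithinAt₀
    exact ⟨α, hα0, fun t ht => (hα t (Set.Ioo_subset_Icc_self ht)).hasDerivAt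
      (Icc_mem_nhds ht.1 ht.2)⟩
  choose α hα0 hα using hloc
  have hmono : ∀ S T : NNReal, S ≤ T → Set.EqOn (α S) (α T) (Set.Ioo (-S : ℝ) S) :=
    fun S T hST t ht => by
      have hST' : (S : ℝ) ≤ T := hST
      have hS : (0 : ℝ) < S := by linarith [ht.1, ht.2]
      exact ODE_solution_unique_of_mem_Ioo (v := fun _ => v) (s := fun _ => Set.univ) (t₀ := 0)
        (fun _ _ => hv.lipschitzOnWith) ⟨neg_lt_zero.2 hS, hS⟩
        (fun u hu => ⟨hα S u hu, trivial⟩)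
        (fun u hu => ⟨hα T u ⟨by linarith [hu.1], by linarith [hu.2]⟩, trivial⟩)
        ((hα0 S).trans (hα0 T).symm) ht
  refine ⟨fun t => α (‖t‖₊ + 1) t, hα0 _, fun t => ?_⟩
  have ht : t ∈ Set.Ioo (-(‖t‖₊ + 1 : NNReal) : ℝ) (‖t‖₊ + 1 : NNReal) := by
    rw [Set.mem_Ioo, ← abs_lt]
    simp
  refine (hα _ t ht).congr_of_eventuallyEq ?_
  filter_upwards [Ioo_mem_nhds ht.1 ht.2] with s hs
  have hs' : s ∈ Set.Ioo (-(‖s‖₊ + 1 : NNReal) : ℝ) (‖s‖₊ + 1 : NNReal) := by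
    rw [Set.mem_Ioo, ← abs_lt]
    simp
  rcases le_total (‖s‖₊ + 1) (‖t‖₊ + 1) with h | h
  · exact hmono _ _ h hs'
  · exact (hmono _ _ h hs).symm

/-- Solutions that start together stay together, if one of them stays in an open set on which the
vector field coincides with a Lipschitz one. -/
theorem eqOn_of_solution {E : Type*} [NormedAddCommGroup E] [NormedSpace ℝ E]
    {v : E → E} {C : NNReal} (hv : LipschitzWith C v) {U : Set E} (hU : IsOpen U) {φ ψ : ℝ → E}
    (hφ : ∀ t, HasDerivAt φ (v (φ t)) t) (hφU : ∀ t, φ t ∈ U) {a b : ℝ} (ha : a < 0) (hb : 0 < b)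
    (h0 : ψ 0 = φ 0) (hψc : ContinuousOn ψ (Set.Ioo a b))
    (hψ : ∀ t ∈ Set.Ioo a b, ψ t ∈ U → HasDerivAt ψ (v (ψ t)) t) :
    Set.EqOn ψ φ (Set.Ioo a b) := by
  have hcont : ∀ t ∈ Set.Ioo a b, ContinuousAt ψ t := fun t ht =>
    hψc.continuousAt (Ioo_mem_nhds ht.1 ht.2)
  have hloc : ∀ t ∈ Set.Ioo a b, ψ t = φ t → ψ =ᶠ[nhds t] φ := fun t ht heq => by
    refine ODE_solution_unique_of_eventually (v := fun _ => v) (s := fun _ => Set.univ)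
      (.of_forall fun _ => hv.lipschitzOnWith) ?_ (.of_forall fun s => ⟨hφ s, trivial⟩) heq
    have hψU : ψ t ∈ U := heq ▸ hφU t
    filter_upwards [Ioo_mem_nhds ht.1 ht.2, (hcont t ht).preimage_mem_nhds (hU.mem_nhds hψU)]
      with s hs hsU
    exact ⟨hψ s hs hsU, trivial⟩
  have hsub : Set.Ioo a b ⊆ {t | ψ =ᶠ[nhds t] φ} := by
    refine isPreconnected_Ioo.subset_of_closure_inter_subset isOpen_setOfPred_eventually_nhds
      ⟨0, ⟨ha, hb⟩, hloc 0 ⟨ha, hb⟩ h0⟩ ?_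
    rintro t ⟨htc, ht⟩
    refine hloc t ht ?_
    by_contra hne
    have hev := ((hcont t ht).prodMk (hφ t).continuousAt).preimage_mem_nhds
      (isOpen_ne_fun continuous_fst continuous_snd |>.mem_nhds hne)
    obtain ⟨s, hs, hsne⟩ := ((mem_closure_iff_frequently.1 htc).and_eventually hev).exists
    exact hsne hs.self_of_nhds
  exact fun t ht => (hsub ht).self_of_nhds

/-- The vector field obtained from the gradient of a compactly supported function by a linear map is
bounded and Lipschitz. -/
theorem exists_lipschitz_bound_gradient {E : Type*} [NormedAddCommGroup E] [InnerProductSpace ℝ E]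
    [CompleteSpace E] {f : E → ℝ} (hf : ContDiff ℝ 2 f) (hs : HasCompactSupport f)
    (S : E →L[ℝ] E) :
    ∃ C L : NNReal, LipschitzWith C (fun x => S (gradient f x)) ∧
      ∀ x, ‖S (gradient f x)‖ ≤ L := by
  have h1 : ContDiff ℝ 1 (fderiv ℝ f) := hf.fderiv_right (by norm_num)
  have h2 : HasCompactSupport (fderiv ℝ f) := hs.fderiv ℝ
  obtain ⟨C, hC⟩ := h1.lipschitzWith_of_hasCompactSupport h2 one_ne_zero
  obtain ⟨L, hL⟩ := h2.exists_bound_of_continuous h1.continuous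
  have hL0 : 0 ≤ L := (norm_nonneg _).trans (hL 0)
  -- the gradient is the image of the derivative under the Riesz isometry
  refine ⟨‖S‖₊ * (1 * C), ‖S‖₊ * ⟨L, hL0⟩,
    S.lipschitz.comp ((InnerProductSpace.toDual ℝ E).symm.lipschitz.comp hC), fun x => ?_⟩
  refine (S.le_opNorm _).trans (mul_le_mul_of_nonneg_left ?_ (norm_nonneg _))
  rw [gradient, LinearIsometryEquiv.norm_map]
  exact hL x

/-! ### Nonlinear stability -/

theorem inner_opMinv_opK_self {Γ : Fin n → ℝ} (hΓ : ∀ i, 0 < Γ i) (w : Config n) :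
    inner ℝ w (opMinv Γ (opK n w)) = 0 := by
  have h1 := inner_opK_opM Γ (opMinv Γ w)
  rwa [opM_opMinv hΓ, ← opMinv_opK, real_inner_comm] at h1

theorem isSolutionOn_iff {Γ : Fin n → ℝ} (hΓ : ∀ i, 0 < Γ i) {ω : ℝ} {φ : ℝ → Config n}
    {S : Set ℝ} : IsSolutionOn Γ ω φ S ↔ ∀ t ∈ S, CollisionFree (φ t) ∧
      HasDerivAt φ (opMinv Γ (opK n (gradient (energy Γ ω) (φ t)))) t := by
  refine forall₂_congr fun t _ => and_congr_right fun hcf => ?_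
  rw [(hasGradientAt_energy Γ ω hcf).gradient]
  constructor
  · rintro ⟨v, hv, hMv⟩
    rwa [← hMv, opMinv_opM hΓ]
  · exact fun h => ⟨_, h, opM_opMinv hΓ _⟩

/-- The energy can be cut off to a smooth function of compact support without changing it near the
orbit `γ`. -/
theorem exists_energy_cutoff (Γ : Fin n → ℝ) (ω : ℝ) (z₀ : Config n) {r : ℝ} (hr : 0 < r)
    (hcf : ∀ z, Metric.infDist z (orbitCircle z₀) < r → CollisionFree z) :
    ∃ f : Config n → ℝ, ContDiff ℝ 2 f ∧ HasCompactSupport f ∧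
      ∀ z, Metric.infDist z (orbitCircle z₀) ≤ r / 2 → f z = energy Γ ω z := by
  have hcont : Continuous fun z => Metric.infDist z (orbitCircle z₀) :=
    Metric.continuous_infDist_pt _
  have hopen : IsOpen {z | Metric.infDist z (orbitCircle z₀) < 3 * r / 4} :=
    isOpen_lt hcont continuous_const
  have hclosed : ∀ c, IsClosed {z | Metric.infDist z (orbitCircle z₀) ≤ c} := fun c =>
    isClosed_le hcont continuous_const
  obtain ⟨χ, hχ, -, hsupp, hone⟩ := exists_contMDiff_support_eq_eq_one_iff (n := 2)
    (modelWithCornersSelf ℝ (Config n)) hopen (hclosed (r / 2))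
    (fun z hz => by rw [Set.mem_ofPred_eq] at hz ⊢; linarith)
  have hχ' : ContDiff ℝ 2 χ := contMDiff_iff_contDiff.1 hχ
  have htsupp : tsupport χ ⊆ {z | Metric.infDist z (orbitCircle z₀) ≤ 3 * r / 4} := by
    refine closure_minimal ?_ (hclosed _)
    rw [hsupp]
    exact fun z hz => le_of_lt (Set.mem_ofPred_eq ▸ hz)
  have hcompact : HasCompactSupport χ := by
    refine IsCompact.of_isClosed_subset ?_ (isClosed_tsupport _) htsupp
    refine Metric.isCompact_of_isClosed_isBounded (hclosed _)
      ((Metric.isBounded_closedBall (x := 0) (r := ‖z₀‖ + 3 * r / 4)).subset fun z hz => ?_)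
    obtain ⟨a, ha, -⟩ := exists_rot_nearest z₀ z
    rw [Set.mem_ofPred_eq, ← ha] at hz
    rw [mem_closedBall_zero_iff, ← norm_rot a]
    exact (norm_le_norm_add_norm_sub' _ z₀).trans (by gcongr)
  refine ⟨fun z => χ z * energy Γ ω z, ?_, hcompact.mul_right, fun z hz => ?_⟩
  · refine contDiff_iff_contDiffAt.2 fun z => ?_
    by_cases hz : z ∈ tsupport χ
    swap
    · refine (contDiffAt_const (c := (0 : ℝ))).congr_of_eventuallyEq ?_
      filter_upwards [notMem_tsupport_iff_eventuallyEq.1 hz] with w hw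
      simp [hw]
    have hz' := htsupp hz
    refine hχ'.contDiffAt.mul (contDiffAt_energy (k := 2) Γ ω (hcf z ?_))
    rw [Set.mem_ofPred_eq] at hz'
    linarith
  · simp only [(hone z).1 hz, one_mul]

end PointVortex

theorem mainTheorem2 {n : ℕ} (hn : 2 ≤ n) (Γ : Fin n → ℝ) (hΓ : ∀ i, 0 < Γ i)
    (ω : ℝ) (z₀ : PointVortex.Config n)
    (hz₀ : PointVortex.IsRelativeEquilibrium Γ ω z₀)
    (hlin : PointVortex.IsLinearlyStable Γ ω z₀) :
    PointVortex.IsNonlinearlyStable Γ ω z₀ := by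
  open PointVortex in
  obtain ⟨r, hr, c, hc, hgrow⟩ := exists_energy_growth hn hΓ hz₀ hlin
  obtain ⟨f, hfc, hfs, hfE⟩ := exists_energy_cutoff Γ ω z₀ hr fun z hz => (hgrow z hz).1
  obtain ⟨C, L, hLip, hbound⟩ := exists_lipschitz_bound_gradient hfc hfs (opMinv Γ ∘L opK n)
  have hcont : Continuous fun z => Metric.infDist z (orbitCircle z₀) :=
    Metric.continuous_infDist_pt _
  have hgrad : ∀ z, Metric.infDist z (orbitCircle z₀) < r / 2 →
      gradient f z = gradient (energy Γ ω) z := fun z hz => by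
    have h : f =ᶠ[nhds z] energy Γ ω := by
      filter_upwards [(isOpen_lt hcont continuous_const).mem_nhds hz] with w hw
      exact hfE w (le_of_lt hw)
    simp only [gradient, h.fderiv_eq]
  intro ε hε
  set e := min ε (r / 2) with he
  have he0 : 0 < e := lt_min hε (by positivity)
  have her : e ≤ r / 2 := min_le_right _ _
  have hEcont : ContinuousAt (energy Γ ω) z₀ :=
    (contDiffAt_energy (k := 0) Γ ω hz₀.collisionFree).continuousAt
  obtain ⟨δ, hδ, hδE⟩ := Metric.continuousAt_iff.1 hEcont (c * e ^ 2) (by positivity)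
  refine ⟨min δ e, lt_min hδ he0, fun ζ₀ hζ₀ => ?_⟩
  obtain ⟨φ, hφ0, hφ⟩ := exists_global_solution hLip hbound ζ₀
  have hζd : Metric.infDist ζ₀ (orbitCircle z₀) < e := by
    have hmem : z₀ ∈ orbitCircle z₀ := ⟨0, rot_zero z₀⟩
    refine (Metric.infDist_le_dist_of_mem hmem).trans_lt ?_
    rw [dist_eq_norm]
    exact hζ₀.trans_le (min_le_right _ _)
  have hζE : energy Γ ω ζ₀ - energy Γ ω z₀ < c * e ^ 2 :=
    (le_abs_self _).trans_lt (hδE (by rw [dist_eq_norm]; exact hζ₀.trans_le (min_le_left _ _)))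
  -- the cut-off energy is conserved along its Hamiltonian flow
  have hcons : ∀ t, f (φ t) = energy Γ ω ζ₀ := fun t => by
    have hder : ∀ s, HasDerivAt (fun s => f (φ s)) 0 s := fun s => by
      have h1 := ((hfc.differentiable two_ne_zero (φ s)).hasGradientAt.hasFDerivAt).comp_hasDerivAt
        s (hφ s)
      exact h1.congr_deriv (inner_opMinv_opK_self hΓ _)
    rw [← hfE ζ₀ (hζd.le.trans her), ← hφ0]
    exact is_const_of_deriv_eq_zero (fun s => (hder s).differentiableAt)
      (fun s => (hder s).deriv) t 0
  have hφc : Continuous φ := continuous_iff_continuousAt.2 fun t => (hφ t).continuousAt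
  -- the distance to the orbit cannot reach `e`, where the energy exceeds its initial value
  have hstay : ∀ t, Metric.infDist (φ t) (orbitCircle z₀) < e := fun t => by
    by_contra! hge
    obtain ⟨s, hs⟩ : e ∈ Set.range fun s => Metric.infDist (φ s) (orbitCircle z₀) :=
      mem_range_of_exists_le_of_exists_ge (hcont.comp hφc) ⟨0, by rw [hφ0]; exact hζd.le⟩ ⟨t, hge⟩
    simp only at hs
    have h1 := (hgrow (φ s) (by linarith)).2
    rw [← hfE (φ s) (by linarith), hcons, hs] at h1
    linarith
  refine ⟨φ, ⟨hφ0, ?_, ?_⟩, fun t => (hstay t).trans_le (min_le_left _ _)⟩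
  · refine (isSolutionOn_iff hΓ).2 fun t _ => ⟨(hgrow _ (by linarith [hstay t])).1, ?_⟩
    rw [← hgrad _ ((hstay t).trans_le her)]
    exact hφ t
  · intro a b ψ ha hb hψ0 hψ
    rw [isSolutionOn_iff hΓ] at hψ
    refine eqOn_of_solution hLip (isOpen_lt hcont continuous_const) hφ hstay ha hb
      (hψ0.trans hφ0.symm) (fun t ht => (hψ t ht).2.continuousAt.continuousWithinAt)
      fun t ht htU => ?_
    have := (hψ t ht).2
    rw [← hgrad _ (lt_of_lt_of_le htU her)] at this
    exact this
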